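/- **Theorem (moment estimators for the spherical cardioid distribution of order $1$).** Let $d\ge 1$, $\boldsymbol\mu\in\mathbb S^d=\{\boldsymbol x\in\mathbb R^{d+1}:\|\boldsymbol x\|=1\}$ and $0<\rho<1$. Let $\boldsymbol X_1,\boldsymbol X_2,\ldots$ be independent random vectors with the spherical cardioid distribution $\mathrm C_1(\boldsymbol\mu,\rho)$, that is, with density $\boldsymbol x\mapsto \omega_d^{-1}(1+\rho\,\boldsymbol x^\top\boldsymbol\mu)$ on $\mathbb S^d$ with respect to the surface area measure, where $\omega_d=2\pi^{(d+1)/2}/\Gamma((d+1)/2)$ is the surface area of $\mathbb S^d$. For $n\ge1$ let $\bar{\boldsymbol X}=\frac1n\sum_{i=1}^n\boldsymbol X_i$ and $$\hat{\boldsymbol\mu}_n=\frac{\bar{\boldsymbol X}}{\|\bar{\boldsymbol X}\|},\qquad \hat\rho_n=(d+1)\|\bar{\boldsymbol X}\|.$$ Then: (i) the estimators are strongly consistent: $(\hat{\boldsymbol\mu}_n,\hat\rho_n)\to(\boldsymbol\mu,\rho)$ almost surely as $n\to\infty$; (ii) the estimators are jointly asymptotically normal: as $n\to\infty$, $$\sqrt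 n\begin{pmatrix}\hat{\boldsymbol\mu}_n-\boldsymbol\mu\\ \hat\rho_n-\rho\end{pmatrix}\rightsquigarrow \mathcal N_{d+2}\left(\boldsymbol 0,\begin{pmatrix}(d+1)\rho^{-2}(\boldsymbol I_{d+1}-\boldsymbol\mu\boldsymbol\mu^\top)&\boldsymbol 0\\ \boldsymbol 0^\top&d+1-\rho^2\end{pmatrix}\right)$$ in distribution, the matrix on the right being positive semidefinite. -/

import Mathlib

open MeasureTheory ProbabilityTheory Filter Topology
open scoped Matrix

noncomputable section

namespace SphericalCardioid

/-- The Gegenbauer polynomials of index `l`, by their three-term recurrence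
`(k+2) C_{k+2} = 2 (k+1+l) x C_{k+1} - (k+2l) C_k`. -/
def gegenbauer (l : ℝ) : ℕ → ℝ → ℝ
  | 0, _ => 1
  | 1, x => 2 * l * x
  | k + 2, x =>
      (2 * ((k : ℝ) + 1 + l) * x * gegenbauer l (k + 1) x
        - ((k : ℝ) + 2 * l) * gegenbauer l k x) / ((k : ℝ) + 2)

/-- The polynomials of index `(d - 1) / 2` attached to the sphere of dimension `d`: Gegenbauer for
`d ≥ 2`, with the convention that for `d = 1` they are the Chebyshev polynomials of the first
kind. -/
def zonalPoly (d k : ℕ) (x : ℝ) : ℝ :=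
  if d = 1 then (Polynomial.Chebyshev.T ℝ (k : ℤ)).eval x else gegenbauer (((d : ℝ) - 1) / 2) k x

/-- The normalized polynomials, with value `1` at `x = 1`. -/
def normalizedZonalPoly (d k : ℕ) (x : ℝ) : ℝ :=
  zonalPoly d k x / zonalPoly d k 1

/-- The unit sphere of dimension `d` in the Euclidean space of dimension `d + 1`. -/
abbrev Sph (d : ℕ) : Type := Metric.sphere (0 : EuclideanSpace ℝ (Fin (d + 1))) 1

/-- The surface area of the unit sphere of dimension `d`. -/
def sphereArea (d : ℕ) : ℝ :=
  2 * Real.pi ^ (((d : ℝ) + 1) / 2) / Real.Gamma (((d : ℝ) + 1) / 2)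

/-- The surface area measure on the unit sphere of dimension `d`. -/
def surfaceMeasure (d : ℕ) : Measure (Sph d) :=
  (volume : Measure (EuclideanSpace ℝ (Fin (d + 1)))).toSphere

/-- The spherical cardioid density of order `k`, location `m` and concentration `ρ`. -/
def cardioidDensity (d k : ℕ) (m : Sph d) (ρ : ℝ) (x : Sph d) : ℝ :=
  (1 / sphereArea d) * (1 + ρ * normalizedZonalPoly d k
    (inner ℝ (x : EuclideanSpace ℝ (Fin (d + 1))) (m : EuclideanSpace ℝ (Fin (d + 1)))))

/-- The spherical cardioid distribution of order `k`: the measure on the sphere with the above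
density with respect to the surface area measure. -/
def cardioid (d k : ℕ) (m : Sph d) (ρ : ℝ) : Measure (Sph d) :=
  (surfaceMeasure d).withDensity fun x => ENNReal.ofReal (cardioidDensity d k m ρ x)

/-- The mean of the first `n` terms of a sequence of points of the sphere. -/
def sampleMean {d : ℕ} (n : ℕ) (x : ℕ → Sph d) : EuclideanSpace ℝ (Fin (d + 1)) :=
  (n : ℝ)⁻¹ • ∑ i ∈ Finset.range n, (x i : EuclideanSpace ℝ (Fin (d + 1)))

/-- The moment estimator of the location, from the first `n` observations. -/
def locationEstimator {d : ℕ} (n : ℕ) (x : ℕ → Sph d) : EuclideanSpace ℝ (Fin (d + 1)) :=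
  ‖sampleMean n x‖⁻¹ • sampleMean n x

/-- The moment estimator of the concentration, from the first `n` observations. -/
def concentrationEstimator {d : ℕ} (n : ℕ) (x : ℕ → Sph d) : ℝ :=
  ((d : ℝ) + 1) * ‖sampleMean n x‖

/-- The joint vector `(u, t)` of dimension `d + 2` made of `u` of dimension `d + 1` and a
scalar `t`. -/
def joint {d : ℕ} (u : EuclideanSpace ℝ (Fin (d + 1))) (t : ℝ) :
    EuclideanSpace ℝ (Fin (d + 1) ⊕ Unit) :=
  WithLp.toLp 2 (Sum.elim (fun i => u i) (fun _ => t))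

/-- The block-diagonal matrix with blocks `(d + 1) ρ⁻² (I - m mᵀ)` and `d + 1 - ρ²`. -/
def asymptoticCovariance {d : ℕ} (m : Sph d) (ρ : ℝ) :
    Matrix (Fin (d + 1) ⊕ Unit) (Fin (d + 1) ⊕ Unit) ℝ :=
  Matrix.fromBlocks
    ((((d : ℝ) + 1) / ρ ^ 2) •
      ((1 : Matrix (Fin (d + 1)) (Fin (d + 1)) ℝ)
        - Matrix.vecMulVec (fun i => (m : EuclideanSpace ℝ (Fin (d + 1))) i)
            (fun i => (m : EuclideanSpace ℝ (Fin (d + 1))) i)))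
    0 0
    (Matrix.of fun _ _ => (d : ℝ) + 1 - ρ ^ 2)

end SphericalCardioid

end

/-! Both estimators are one function of the sample mean, `momentMap`: y ↦ (y/‖y‖, (d+1)‖y‖). By
symmetry of the sphere, the cardioid law has mean cμ with c = ρ/(d+1), and covariance (d+1)⁻¹I −
c²μμᵀ. Since c > 0, `momentMap` is continuous and differentiable at cμ and takes the value (μ, ρ)
there. The strong law therefore gives (i), and the central limit theorem with the delta method gives
(ii).

The derivative at cμ (`hasFDerivAt_momentMap`) sends z to c⁻¹ times its part tangent at μ, paired
with d+1 times its radial part. These parts are uncorrelated, whence the diagonal blocks: c⁻²/(d+1)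
= (d+1)/ρ² on the tangent space, and (d+1)²((d+1)⁻¹ − c²) = d+1−ρ² radially
(`map_momentMapDeriv_multivariateGaussian`). -/

namespace SphericalCardioid

/-! ### Symmetries and low moments of surface measure. -/

section SphereMoments

variable {E : Type*} [NormedAddCommGroup E] [InnerProductSpace ℝ E] [FiniteDimensional ℝ E]
  [MeasurableSpace E] [BorelSpace E]

/-- The self-map of the unit sphere induced by a linear isometry. -/
def sphereMap (f : E ≃ₗᵢ[ℝ] E) (x : Metric.sphere (0 : E) 1) : Metric.sphere (0 : E) 1 :=
  ⟨f x, by simp⟩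

-- Surface measure of s is the dimension times the volume of the cone over s; a linear isometry maps
-- cones to cones and preserves volume.
open scoped Pointwise in
theorem measurePreserving_sphereMap (f : E ≃ₗᵢ[ℝ] E) :
    MeasurePreserving (sphereMap f) (volume : Measure E).toSphere
      (volume : Measure E).toSphere := by
  have hm : Measurable (sphereMap f) :=
    (Continuous.subtype_mk (f.continuous.comp continuous_subtype_val) _).measurable
  refine ⟨hm, ?_⟩
  ext s hs
  rw [Measure.map_apply hm hs, Measure.toSphere_apply' _ (hm hs), Measure.toSphere_apply' _ hs]
  congr 1
  rw [← f.measurePreserving.measure_preimage_emb f.toHomeomorph.measurableEmbedding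
    (Set.Ioo (0 : ℝ) 1 • ((↑) '' s : Set E))]
  congr 1
  ext y
  simp only [Set.mem_preimage, Set.mem_smul, Set.mem_image]
  constructor
  · rintro ⟨r, hr, z, ⟨x, hx, rfl⟩, rfl⟩
    exact ⟨r, hr, _, ⟨sphereMap f x, hx, rfl⟩, by simp [sphereMap]⟩
  · rintro ⟨r, hr, z, ⟨x, hx, rfl⟩, h⟩
    refine ⟨r, hr, _, ⟨sphereMap f.symm x, ?_, rfl⟩, ?_⟩
    · have : sphereMap f (sphereMap f.symm x) = x := by ext; simp [sphereMap]
      simpa [this] using hx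
    · apply f.injective
      simpa [sphereMap] using h

theorem integral_sphereMap (f : E ≃ₗᵢ[ℝ] E) (g : Metric.sphere (0 : E) 1 → ℝ)
    (hg : Continuous g) :
    ∫ x, g (sphereMap f x) ∂(volume : Measure E).toSphere
      = ∫ x, g x ∂(volume : Measure E).toSphere := by
  have h := measurePreserving_sphereMap f
  conv_rhs => rw [← h.map_eq]
  rw [integral_map h.measurable.aemeasurable hg.aestronglyMeasurable]

theorem integrable_of_continuous_sphere {g : Metric.sphere (0 : E) 1 → ℝ} (hg : Continuous g) :
    Integrable g (volume : Measure E).toSphere := by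
  obtain ⟨C, hC⟩ := isCompact_univ.exists_bound_of_continuousOn hg.continuousOn
  exact Integrable.of_bound hg.aestronglyMeasurable C (ae_of_all _ fun x => hC x trivial)

theorem integral_sphere_eq_zero_of_odd (g : Metric.sphere (0 : E) 1 → ℝ) (hg : Continuous g)
    (hodd : ∀ x, g (sphereMap (LinearIsometryEquiv.neg ℝ) x) = -g x) :
    ∫ x, g x ∂(volume : Measure E).toSphere = 0 := by
  have h := integral_sphereMap (LinearIsometryEquiv.neg ℝ) g hg
  simp_rw [hodd, integral_neg] at h
  linarith

theorem integral_inner_sphere (u : E) :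
    ∫ x : Metric.sphere (0 : E) 1, inner ℝ (x : E) u ∂(volume : Measure E).toSphere = 0 :=
  integral_sphere_eq_zero_of_odd _ (by fun_prop) fun x => by simp [sphereMap]

theorem integral_inner_sq_mul_inner_sphere (u v : E) :
    ∫ x : Metric.sphere (0 : E) 1, inner ℝ (x : E) u ^ 2 * inner ℝ (x : E) v
      ∂(volume : Measure E).toSphere = 0 :=
  integral_sphere_eq_zero_of_odd _ (by fun_prop) fun x => by simp [sphereMap]

theorem integral_inner_sq_sphere_congr {u v : E} (h : ‖u‖ = ‖v‖) :
    ∫ x : Metric.sphere (0 : E) 1, inner ℝ (x : E) u ^ 2 ∂(volume : Measure E).toSphere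
      = ∫ x : Metric.sphere (0 : E) 1, inner ℝ (x : E) v ^ 2 ∂(volume : Measure E).toSphere := by
  -- The reflection in the hyperplane orthogonal to u − v.
  obtain ⟨f, rfl⟩ : ∃ f : E ≃ₗᵢ[ℝ] E, f u = v := ⟨_, Submodule.reflection_sub h⟩
  rw [← integral_sphereMap f (fun x => inner ℝ (x : E) (f u) ^ 2) (by fun_prop)]
  simp [sphereMap]

/-- All unit directions have the same second moment, and over an orthonormal basis the squared
coordinates sum to 1. -/
theorem integral_inner_sq_sphere (u : E) :
    Module.finrank ℝ E * ∫ x : Metric.sphere (0 : E) 1, inner ℝ (x : E) u ^ 2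
        ∂(volume : Measure E).toSphere
      = ‖u‖ ^ 2 * (volume : Measure E).toSphere.real Set.univ := by
  let b := stdOrthonormalBasis ℝ E
  have hb (i) : ∫ x : Metric.sphere (0 : E) 1, inner ℝ (x : E) u ^ 2
        ∂(volume : Measure E).toSphere
      = ‖u‖ ^ 2 * ∫ x : Metric.sphere (0 : E) 1, inner ℝ (x : E) (b i) ^ 2
        ∂(volume : Measure E).toSphere := by
    rw [integral_inner_sq_sphere_congr (v := ‖u‖ • b i) (by simp [norm_smul]),
      ← integral_const_mul]
    simp [real_inner_smul_right, mul_pow]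
  have hs : ∑ i, ∫ x : Metric.sphere (0 : E) 1, inner ℝ (x : E) (b i) ^ 2
      ∂(volume : Measure E).toSphere = (volume : Measure E).toSphere.real Set.univ := by
    rw [← integral_finsetSum _ fun i _ => integrable_of_continuous_sphere (by fun_prop)]
    simp [b.sum_sq_inner_left]
  rw [← hs, Finset.mul_sum, ← Finset.sum_congr rfl fun i _ => hb i]
  simp

/-- Polarization of the quadratic case. -/
theorem integral_inner_mul_inner_sphere (u v : E) :
    Module.finrank ℝ E * ∫ x : Metric.sphere (0 : E) 1, inner ℝ (x : E) u * inner ℝ (x : E) v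
        ∂(volume : Measure E).toSphere
      = inner ℝ u v * (volume : Measure E).toSphere.real Set.univ := by
  have h : ∫ x : Metric.sphere (0 : E) 1, inner ℝ (x : E) u * inner ℝ (x : E) v
        ∂(volume : Measure E).toSphere
      = (1 / 4) * (∫ x : Metric.sphere (0 : E) 1, inner ℝ (x : E) (u + v) ^ 2
        ∂(volume : Measure E).toSphere - ∫ x : Metric.sphere (0 : E) 1, inner ℝ (x : E) (u - v) ^ 2
        ∂(volume : Measure E).toSphere) := by
    rw [← integral_sub (integrable_of_continuous_sphere (by fun_prop))
      (integrable_of_continuous_sphere (by fun_prop)), ← integral_const_mul]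
    refine integral_congr_ae (ae_of_all _ fun x => ?_)
    simp only [inner_add_right, inner_sub_right]
    ring
  have h1 := integral_inner_sq_sphere (u + v)
  have h2 := integral_inner_sq_sphere (u - v)
  rw [norm_add_sq_real] at h1
  rw [norm_sub_sq_real] at h2
  rw [h]
  linear_combination (1 / 4) * h1 - (1 / 4) * h2

end SphereMoments

/-! ### Total surface area and moments of the cardioid law. -/

theorem sphereArea_pos (d : ℕ) : 0 < sphereArea d := by
  unfold sphereArea
  have : 0 < Real.Gamma (((d : ℝ) + 1) / 2) := Real.Gamma_pos_of_pos (by positivity)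
  positivity

theorem surfaceMeasure_real_univ (d : ℕ) : (surfaceMeasure d).real Set.univ = sphereArea d := by
  have hG : 0 < Real.Gamma (((d : ℝ) + 1) / 2) := Real.Gamma_pos_of_pos (by positivity)
  rw [surfaceMeasure, Measure.toSphere_real_apply_univ, measureReal_def,
    EuclideanSpace.volume_ball]
  have h : Real.Gamma (((d : ℝ) + 1) / 2 + 1) =
      ((d : ℝ) + 1) / 2 * Real.Gamma (((d : ℝ) + 1) / 2) :=
    Real.Gamma_add_one (by positivity)
  have hp : √Real.pi ^ (d + 1) = Real.pi ^ (((d : ℝ) + 1) / 2) := by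
    rw [Real.sqrt_eq_rpow, ← Real.rpow_natCast, ← Real.rpow_mul Real.pi_pos.le]
    congr 1
    push_cast
    ring
  simp only [Fintype.card_fin, finrank_euclideanSpace, Nat.cast_add, Nat.cast_one, h, hp,
    ENNReal.ofReal_one, one_pow, one_mul]
  rw [ENNReal.toReal_ofReal (by positivity), sphereArea]
  field_simp

section CardioidMoments

variable {d : ℕ}

theorem normalizedZonalPoly_one (hd : 1 ≤ d) (x : ℝ) : normalizedZonalPoly d 1 x = x := by
  unfold normalizedZonalPoly zonalPoly
  split_ifs with h
  · simp
  -- The normalizing value at 1 is d − 1, nonzero because d = 1 is the Chebyshev case.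
  · have : (1 : ℝ) < d := by exact_mod_cast (by omega : 1 < d)
    simp only [gegenbauer]
    field_simp [(by linarith : (d : ℝ) - 1 ≠ 0)]

theorem abs_inner_le_one (x m : Sph d) :
    |inner ℝ (x : EuclideanSpace ℝ (Fin (d + 1))) (m : EuclideanSpace ℝ (Fin (d + 1)))| ≤ 1 := by
  simpa using abs_real_inner_le_norm (x : EuclideanSpace ℝ (Fin (d + 1)))
    (m : EuclideanSpace ℝ (Fin (d + 1)))

theorem integral_cardioid (hd : 1 ≤ d) (m : Sph d) {ρ : ℝ} (hρ0 : 0 < ρ) (hρ1 : ρ < 1)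
    {g : Sph d → ℝ} (hg : Continuous g) :
    ∫ x, g x ∂(cardioid d 1 m ρ)
      = (sphereArea d)⁻¹ * (∫ x, g x ∂(surfaceMeasure d)
        + ρ * ∫ x, g x * inner ℝ (x : EuclideanSpace ℝ (Fin (d + 1)))
          (m : EuclideanSpace ℝ (Fin (d + 1))) ∂(surfaceMeasure d)) := by
  have hω := sphereArea_pos d
  have hden (x : Sph d) : cardioidDensity d 1 m ρ x = (sphereArea d)⁻¹ *
      (1 + ρ * inner ℝ (x : EuclideanSpace ℝ (Fin (d + 1)))
        (m : EuclideanSpace ℝ (Fin (d + 1)))) := by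
    rw [cardioidDensity, normalizedZonalPoly_one hd, one_div]
  -- `ENNReal.ofReal` truncates negative values, so positivity of the density is needed to recover
  -- it.
  have hnn (x : Sph d) : 0 ≤ cardioidDensity d 1 m ρ x := by
    rw [hden]
    have h := abs_le.1 (abs_inner_le_one x m)
    exact mul_nonneg (inv_nonneg.2 hω.le) (by nlinarith)
  have hc : Continuous (cardioidDensity d 1 m ρ) := by
    rw [funext hden]
    fun_prop
  unfold surfaceMeasure
  rw [cardioid, surfaceMeasure,
    integral_withDensity_eq_integral_toReal_smul (by fun_prop) (by simp),
    ← integral_const_mul, ← integral_add (integrable_of_continuous_sphere hg)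
      (integrable_of_continuous_sphere (by fun_prop)), ← integral_const_mul]
  refine integral_congr_ae (ae_of_all _ fun x => ?_)
  simp only [ENNReal.toReal_ofReal (hnn x), smul_eq_mul]
  rw [hden]
  ring

theorem integral_inner_cardioid (hd : 1 ≤ d) (m : Sph d) {ρ : ℝ} (hρ0 : 0 < ρ) (hρ1 : ρ < 1)
    (u : EuclideanSpace ℝ (Fin (d + 1))) :
    ∫ x, inner ℝ (x : EuclideanSpace ℝ (Fin (d + 1))) u ∂(cardioid d 1 m ρ)
      = ρ / (d + 1) * inner ℝ (m : EuclideanSpace ℝ (Fin (d + 1))) u := by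
  rw [integral_cardioid hd m hρ0 hρ1 (by fun_prop)]
  have h1 := integral_inner_sphere u
  have h2 := integral_inner_mul_inner_sphere u (m : EuclideanSpace ℝ (Fin (d + 1)))
  have hω := (sphereArea_pos d).ne'
  rw [← surfaceMeasure, surfaceMeasure_real_univ, finrank_euclideanSpace, Fintype.card_fin] at h2
  rw [← surfaceMeasure] at h1
  push_cast at h2
  rw [h1, real_inner_comm]
  field_simp
  linear_combination ρ * h2

/-- The tilt ρ⟨x, m⟩ makes an odd integrand, so second moments agree with the uniform ones. -/
theorem integral_inner_sq_cardioid (hd : 1 ≤ d) (m : Sph d) {ρ : ℝ} (hρ0 : 0 < ρ) (hρ1 : ρ < 1)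
    (u : EuclideanSpace ℝ (Fin (d + 1))) :
    ∫ x, inner ℝ (x : EuclideanSpace ℝ (Fin (d + 1))) u ^ 2 ∂(cardioid d 1 m ρ)
      = ‖u‖ ^ 2 / (d + 1) := by
  rw [integral_cardioid hd m hρ0 hρ1 (by fun_prop)]
  have h1 := integral_inner_sq_mul_inner_sphere u (m : EuclideanSpace ℝ (Fin (d + 1)))
  have h2 := integral_inner_sq_sphere u
  have hω := (sphereArea_pos d).ne'
  rw [← surfaceMeasure, surfaceMeasure_real_univ, finrank_euclideanSpace, Fintype.card_fin] at h2
  rw [← surfaceMeasure] at h1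
  push_cast at h2
  rw [h1]
  field_simp
  linear_combination h2

end CardioidMoments

/-! ### Multivariate central limit theorem by Cramér–Wold. -/

section CentralLimit

open scoped RealInnerProductSpace

theorem charFun_map_eq_charFun_map_inner {Ω E : Type*} [MeasurableSpace Ω] {P : Measure Ω}
    [NormedAddCommGroup E] [InnerProductSpace ℝ E] [MeasurableSpace E] [BorelSpace E]
    [SecondCountableTopology E]
    {Z : Ω → E} (hZ : AEMeasurable Z P) (u : E) :
    charFun (P.map Z) u = charFun (P.map fun ω => ⟪Z ω, u⟫) 1 := by
  rw [charFun_apply, charFun_apply_real, integral_map hZ (by fun_prop),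
    integral_map (by fun_prop) (by fun_prop)]
  simp

/-- The multivariate central limit theorem, with the covariance given by its quadratic form. -/
theorem tendstoInDistribution_sqrt_smul_mean_sub {Ω ι : Type*} [MeasurableSpace Ω] [Fintype ι]
    [DecidableEq ι] {P : Measure Ω} [IsProbabilityMeasure P]
    {X : ℕ → Ω → EuclideanSpace ℝ ι} {S : Matrix ι ι ℝ} (hS : S.PosSemidef)
    (hX : MemLp (X 0) 2 P) (hindep : iIndepFun X P) (hident : ∀ i, IdentDistrib (X i) (X 0) P P)
    (hcov : ∀ u, Var[fun ω => ⟪X 0 ω, u⟫; P] = u ⬝ᵥ S *ᵥ u) :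
    TendstoInDistribution
      (fun (n : ℕ) ω => √n • ((n : ℝ)⁻¹ • ∑ i ∈ Finset.range n, X i ω - P[X 0]))
      atTop id (fun _ => P) (multivariateGaussian 0 S) := by
  have hm i : AEMeasurable (X i) P := (hident i).aemeasurable_fst
  have hZ (n : ℕ) : AEMeasurable
      (fun ω => √n • ((n : ℝ)⁻¹ • ∑ i ∈ Finset.range n, X i ω - P[X 0])) P := by
    fun_prop
  refine ⟨hZ, by fun_prop, ProbabilityMeasure.tendsto_iff_tendsto_charFun.2 fun u => ?_⟩
  have hv : 0 ≤ Var[fun ω => ⟪X 0 ω, u⟫; P] := variance_nonneg _ _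
  have hclt := tendstoInDistribution_inv_sqrt_mul_sum_sub (P := P)
    (X := fun i ω => ⟪X i ω, u⟫) (Y := id) (HasLaw.id (μ := gaussianReal 0 _))
    (hX.inner_const u)
    (hindep.comp (fun _ x => ⟪x, u⟫) fun _ => by fun_prop)
    (fun i => (hident i).comp (u := fun x => ⟪x, u⟫) (by fun_prop))
  -- Frequency 1 suffices, as the direction u is arbitrary.
  have h1 := ProbabilityMeasure.tendsto_iff_tendsto_charFun.1 hclt.tendsto 1
  simp only [ProbabilityMeasure.coe_mk, Measure.map_id, charFun_gaussianReal,
    charFun_multivariateGaussian hS] at h1 ⊢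
  rw [Real.coe_toNNReal _ hv, hcov] at h1
  convert h1 using 2 with n
  · rw [charFun_map_eq_charFun_map_inner (hZ n)]
    congr 2
    ext ω
    have hi : ∫ ω, ⟪X 0 ω, u⟫ ∂P = ⟪P[X 0], u⟫ := by
      rw [← integral_inner (hX.integrable (by norm_num)) u |>.trans (real_inner_comm _ _) ]
      simp_rw [real_inner_comm]
    rw [hi]
    simp only [real_inner_smul_left, inner_sub_left, sum_inner]
    rcases Nat.eq_zero_or_pos n with rfl | hn
    · simp
    · have : (0 : ℝ) < n := by exact_mod_cast hn
      have h2 := Real.mul_self_sqrt this.le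
      field_simp
      rw [Real.sq_sqrt this.le]
  · simp

end CentralLimit

/-! ### Delta method. -/

section DeltaMethod

variable {Ω E F : Type*} [MeasurableSpace Ω]
  [NormedAddCommGroup E] [NormedSpace ℝ E] [MeasurableSpace E] [BorelSpace E]
  [SecondCountableTopology E]
  [NormedAddCommGroup F] [NormedSpace ℝ F] [MeasurableSpace F] [BorelSpace F]
  [SecondCountableTopology F]

/-- The delta method for a strongly consistent sequence of estimators. -/
theorem tendstoInDistribution_delta {P : Measure Ω} [IsProbabilityMeasure P]
    {γ : Measure E} [IsProbabilityMeasure γ] {Y : ℕ → Ω → E} {θ : E} {g : E → F} {A : E →L[ℝ] F}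
    (hY : ∀ n, AEMeasurable (Y n) P) (hg : HasFDerivAt g A θ) (hgm : Measurable g)
    (hlim : ∀ᵐ ω ∂P, Tendsto (fun n => Y n ω) atTop (𝓝 θ))
    (hclt : TendstoInDistribution (fun (n : ℕ) ω => √n • (Y n ω - θ)) atTop id (fun _ => P) γ) :
    TendstoInDistribution (fun (n : ℕ) ω => √n • (g (Y n ω) - g θ)) atTop A (fun _ => P) γ := by
  -- Normalized Taylor remainder. It vanishes at θ, so it tends to 0 along the full neighbourhood
  -- filter, not only the punctured one.
  let r : E → F := fun y => ‖y - θ‖⁻¹ • (g y - g θ - A (y - θ))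
  have hr : Tendsto r (𝓝 θ) (𝓝 0) := by
    rw [tendsto_zero_iff_norm_tendsto_zero]
    simpa [r, norm_smul] using hasFDerivAt_iff_tendsto.1 hg
  have hrm : Measurable r := by
    refine Measurable.smul (by fun_prop) ((hgm.sub_const _).sub ?_)
    exact A.continuous.measurable.comp (by fun_prop)
  have hrY (n : ℕ) : AEMeasurable (fun ω => r (Y n ω)) P := hrm.comp_aemeasurable (hY n)
  have hr0 : TendstoInMeasure P (fun n ω => r (Y n ω)) atTop fun _ => 0 :=
    tendstoInMeasure_of_tendsto_ae (fun n => (hrY n).aestronglyMeasurable)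
      (hlim.mono fun ω hω => hr.comp hω)
  -- Slutsky: with Z = √n(Y − θ), the scaled increment of g is exactly A Z + ‖Z‖ r(Y).
  have h := hclt.continuous_comp_prodMk_of_tendstoInMeasure_const
    (g := fun p : E × F => A p.1 + ‖p.1‖ • p.2) (by fun_prop) hr0 hrY
  convert h using 1
  · ext n ω
    have hnr : ‖Y n ω - θ‖ • r (Y n ω) = g (Y n ω) - g θ - A (Y n ω - θ) := by
      rcases eq_or_ne (Y n ω) θ with h0 | h0
      · simp [h0]
      · exact smul_inv_smul₀ (norm_ne_zero_iff.2 (sub_ne_zero.2 h0)) _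
    rw [norm_smul, Real.norm_of_nonneg (Real.sqrt_nonneg _), mul_smul, hnr, map_smul,
      ← smul_add, add_sub_cancel]
  · ext z
    simp

end DeltaMethod

theorem tendstoInDistribution_id_of_map_eq {Ω E F : Type*} [MeasurableSpace Ω] [MeasurableSpace E]
    [TopologicalSpace F] [MeasurableSpace F] [OpensMeasurableSpace F]
    {P : Measure Ω} [IsProbabilityMeasure P] {γ : Measure E} [IsProbabilityMeasure γ]
    {ν : Measure F} [IsProbabilityMeasure ν] {W : ℕ → Ω → F} {A : E → F}
    (h : TendstoInDistribution W atTop A (fun _ => P) γ) (hA : γ.map A = ν) :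
    TendstoInDistribution W atTop id (fun _ => P) ν := by
  refine ⟨h.forall_aemeasurable, by fun_prop, ?_⟩
  have h' := h.tendsto
  simp only [hA] at h'
  simpa only [Measure.map_id] using h'

/-! ### Linear images of Gaussians and rank-one perturbations. -/

section Gaussian

open scoped RealInnerProductSpace

variable {ι κ : Type*} [Fintype ι] [DecidableEq ι] [Fintype κ] [DecidableEq κ]

/-- B is the transpose of A: the characteristic function of the image at t is the original one at B
t. -/
theorem map_multivariateGaussian_zero {S : Matrix ι ι ℝ} {C : Matrix κ κ ℝ}
    (hS : S.PosSemidef) (hC : C.PosSemidef)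
    {A : EuclideanSpace ℝ ι →L[ℝ] EuclideanSpace ℝ κ}
    {B : EuclideanSpace ℝ κ → EuclideanSpace ℝ ι} (hAB : ∀ z t, ⟪A z, t⟫ = ⟪z, B t⟫)
    (hBC : ∀ t, B t ⬝ᵥ S *ᵥ B t = t ⬝ᵥ C *ᵥ t) :
    (multivariateGaussian 0 S).map A = multivariateGaussian 0 C := by
  have : IsProbabilityMeasure ((multivariateGaussian 0 S).map A) :=
    Measure.isProbabilityMeasure_map (by fun_prop)
  refine Measure.ext_of_charFun (funext fun t => ?_)
  rw [charFun_apply, integral_map (by fun_prop) (by fun_prop)]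
  simp_rw [hAB]
  rw [← charFun_apply, charFun_multivariateGaussian hS, charFun_multivariateGaussian hC, hBC]
  simp

theorem dotProduct_smul_one_sub_vecMulVec (a b : ℝ) (m u : EuclideanSpace ℝ ι) :
    u ⬝ᵥ (a • (1 : Matrix ι ι ℝ) - b • Matrix.vecMulVec m m) *ᵥ u
      = a * ‖u‖ ^ 2 - b * ⟪m, u⟫ ^ 2 := by
  have h1 : (u : ι → ℝ) ⬝ᵥ u = ‖u‖ ^ 2 := by
    rw [← real_inner_self_eq_norm_sq, EuclideanSpace.inner_eq_star_dotProduct]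
    simp
  have h2 : (m : ι → ℝ) ⬝ᵥ u = ⟪m, u⟫ := by
    rw [EuclideanSpace.inner_eq_star_dotProduct, dotProduct_comm]
    simp
  simp only [Matrix.sub_mulVec, Matrix.smul_mulVec, Matrix.one_mulVec, Matrix.vecMulVec_mulVec,
    op_smul_eq_smul, dotProduct_sub, dotProduct_smul, h1, h2, smul_eq_mul,
    dotProduct_comm u.ofLp m.ofLp]
  ring

/-- The eigenvalues are a on the complement of m and a − b along m. -/
theorem posSemidef_smul_one_sub_vecMulVec {a b : ℝ} (ha : 0 ≤ a) (hba : b ≤ a)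
    {m : EuclideanSpace ℝ ι} (hm : ‖m‖ = 1) :
    (a • (1 : Matrix ι ι ℝ) - b • Matrix.vecMulVec m m).PosSemidef := by
  refine .of_dotProduct_mulVec_nonneg ?_ fun x => ?_
  · ext i j
    simp [Matrix.vecMulVec_apply, Matrix.one_apply, eq_comm, mul_comm]
  · have h := dotProduct_smul_one_sub_vecMulVec a b m (WithLp.toLp 2 x)
    simp only [star_trivial] at h ⊢
    rw [h]
    have hcs := abs_real_inner_le_norm m (WithLp.toLp 2 x)
    rw [hm, one_mul] at hcs
    have hsq : ⟪m, WithLp.toLp 2 x⟫ ^ 2 ≤ ‖WithLp.toLp 2 x‖ ^ 2 :=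
      sq_le_sq' (abs_le.1 hcs).1 (abs_le.1 hcs).2
    nlinarith [sq_nonneg ⟪m, WithLp.toLp 2 x⟫]

end Gaussian

/-! ### The moment map, its derivative and the limiting covariance. -/

section Estimators

open scoped RealInnerProductSpace

variable {d : ℕ}

/-- The pairing of a location and a concentration as a continuous linear map. -/
noncomputable def jointCLM (d : ℕ) :
    EuclideanSpace ℝ (Fin (d + 1)) × ℝ →L[ℝ] EuclideanSpace ℝ (Fin (d + 1) ⊕ Unit) :=
  LinearMap.toContinuousLinearMap
    { toFun := fun p => joint p.1 p.2
      map_add' := fun p q => by ext i; cases i <;> simp [joint]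
      map_smul' := fun c p => by ext i; cases i <;> simp [joint] }

@[simp]
theorem jointCLM_apply (p : EuclideanSpace ℝ (Fin (d + 1)) × ℝ) :
    jointCLM d p = joint p.1 p.2 := rfl

theorem inner_joint (u v : EuclideanSpace ℝ (Fin (d + 1))) (s t : ℝ) :
    ⟪joint u s, joint v t⟫ = ⟪u, v⟫ + s * t := by
  simp [joint, PiLp.inner_apply, mul_comm]

theorem exists_eq_joint (x : EuclideanSpace ℝ (Fin (d + 1) ⊕ Unit)) :
    ∃ u t, x = joint u t :=
  ⟨WithLp.toLp 2 fun i => x (Sum.inl i), x (Sum.inr ()), by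
    ext i; cases i <;> simp [joint]⟩

theorem dotProduct_asymptoticCovariance (m : Sph d) (ρ : ℝ) (u : EuclideanSpace ℝ (Fin (d + 1)))
    (t : ℝ) :
    joint u t ⬝ᵥ asymptoticCovariance m ρ *ᵥ joint u t
      = ((d : ℝ) + 1) / ρ ^ 2 *
          (‖u‖ ^ 2 - ⟪(m : EuclideanSpace ℝ (Fin (d + 1))), u⟫ ^ 2)
        + ((d : ℝ) + 1 - ρ ^ 2) * t ^ 2 := by
  have h := dotProduct_smul_one_sub_vecMulVec (((d : ℝ) + 1) / ρ ^ 2) (((d : ℝ) + 1) / ρ ^ 2)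
    (m : EuclideanSpace ℝ (Fin (d + 1))) u
  rw [← smul_sub] at h
  rw [asymptoticCovariance, Matrix.fromBlocks_mulVec]
  simp only [joint, Matrix.zero_mulVec, add_zero, zero_add, sumElim_dotProduct_sumElim,
    Sum.elim_comp_inl, Sum.elim_comp_inr]
  rw [h]
  simp [dotProduct, Matrix.mulVec]
  ring

theorem posSemidef_asymptoticCovariance (m : Sph d) {ρ : ℝ} (hρ : ρ ^ 2 ≤ d + 1) :
    (asymptoticCovariance m ρ).PosSemidef := by
  refine .of_dotProduct_mulVec_nonneg ?_ fun x => ?_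
  · refine Matrix.IsHermitian.fromBlocks ?_ (by simp) (by ext i j; simp)
    ext i j
    simp [Matrix.vecMulVec_apply, Matrix.one_apply, eq_comm, mul_comm]
  · obtain ⟨u, t, hx⟩ := exists_eq_joint (WithLp.toLp 2 x)
    obtain rfl : x = joint u t := congrArg WithLp.ofLp hx
    rw [star_trivial, dotProduct_asymptoticCovariance]
    have hcs := abs_real_inner_le_norm (m : EuclideanSpace ℝ (Fin (d + 1))) u
    rw [norm_eq_of_mem_sphere, one_mul] at hcs
    have hsq := sub_nonneg.2 (sq_le_sq' (abs_le.1 hcs).1 (abs_le.1 hcs).2)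
    have := sub_nonneg.2 hρ
    positivity

/-- The covariance matrix of the spherical cardioid distribution of order one. -/
noncomputable def cardioidCovariance (m : Sph d) (ρ : ℝ) :
    Matrix (Fin (d + 1)) (Fin (d + 1)) ℝ :=
  ((d : ℝ) + 1)⁻¹ • (1 : Matrix (Fin (d + 1)) (Fin (d + 1)) ℝ)
    - (ρ / (d + 1)) ^ 2 • Matrix.vecMulVec (m : EuclideanSpace ℝ (Fin (d + 1)))
      (m : EuclideanSpace ℝ (Fin (d + 1)))

theorem posSemidef_cardioidCovariance (m : Sph d) {ρ : ℝ} (hρ : ρ ^ 2 ≤ d + 1) :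
    (cardioidCovariance m ρ).PosSemidef := by
  refine posSemidef_smul_one_sub_vecMulVec (by positivity) ?_ (norm_eq_of_mem_sphere m)
  rw [div_pow, inv_eq_one_div, div_le_div_iff₀ (by positivity) (by positivity)]
  nlinarith [(Nat.cast_nonneg d : (0 : ℝ) ≤ d)]

/-- The pair of moment estimators as a function of the sample mean. -/
noncomputable def momentMap (d : ℕ) (y : EuclideanSpace ℝ (Fin (d + 1))) :
    EuclideanSpace ℝ (Fin (d + 1) ⊕ Unit) :=
  joint (‖y‖⁻¹ • y) (((d : ℝ) + 1) * ‖y‖)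

theorem measurable_momentMap : Measurable (momentMap d) :=
  (jointCLM d).continuous.measurable.comp
    (f := fun y : EuclideanSpace ℝ (Fin (d + 1)) => (‖y‖⁻¹ • y, ((d : ℝ) + 1) * ‖y‖))
    (by fun_prop)

/-- The derivative of the moment map at `c • m`. -/
noncomputable def momentMapDeriv (m : Sph d) (c : ℝ) :
    EuclideanSpace ℝ (Fin (d + 1)) →L[ℝ] EuclideanSpace ℝ (Fin (d + 1) ⊕ Unit) :=
  let l := innerSL ℝ (m : EuclideanSpace ℝ (Fin (d + 1)))
  jointCLM d ∘L
    (c⁻¹ • (ContinuousLinearMap.id ℝ _ - l.smulRight (m : EuclideanSpace ℝ (Fin (d + 1))))).prod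
      (((d : ℝ) + 1) • l)

theorem momentMapDeriv_apply (m : Sph d) (c : ℝ) (z : EuclideanSpace ℝ (Fin (d + 1))) :
    momentMapDeriv m c z = joint
      (c⁻¹ • (z - ⟪(m : EuclideanSpace ℝ (Fin (d + 1))), z⟫ • (m : EuclideanSpace ℝ (Fin (d + 1)))))
      (((d : ℝ) + 1) * ⟪(m : EuclideanSpace ℝ (Fin (d + 1))), z⟫) := by
  simp [momentMapDeriv]

theorem norm_smul_sphere (m : Sph d) {c : ℝ} (hc : 0 < c) :
    ‖c • (m : EuclideanSpace ℝ (Fin (d + 1)))‖ = c := by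
  rw [norm_smul, norm_eq_of_mem_sphere, mul_one, Real.norm_of_nonneg hc.le]

theorem hasFDerivAt_norm_smul_sphere (m : Sph d) {c : ℝ} (hc : 0 < c) :
    HasFDerivAt (fun y : EuclideanSpace ℝ (Fin (d + 1)) => ‖y‖)
      (innerSL ℝ (m : EuclideanSpace ℝ (Fin (d + 1))))
      (c • (m : EuclideanSpace ℝ (Fin (d + 1)))) := by
  have hn := norm_smul_sphere m hc
  -- The norm is differentiated as the square root of its square, which is nonzero here.
  have h := (hasStrictFDerivAt_norm_sq (c • (m : EuclideanSpace ℝ (Fin (d + 1))))).hasFDerivAt.sqrt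
    (by rw [hn]; positivity)
  simp only [Real.sqrt_sq (norm_nonneg _), hn, Real.sqrt_sq hc.le] at h
  refine h.congr_fderiv ?_
  ext1 z
  simp only [smul_apply, innerSL_apply_apply, real_inner_smul_left,
    smul_eq_mul, nsmul_eq_mul]
  push_cast
  field_simp

theorem hasFDerivAt_momentMap (m : Sph d) {c : ℝ} (hc : 0 < c) :
    HasFDerivAt (momentMap d) (momentMapDeriv m c)
      (c • (m : EuclideanSpace ℝ (Fin (d + 1)))) := by
  have hn := norm_smul_sphere m hc
  have h := hasFDerivAt_norm_smul_sphere m hc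
  have hinv := (hasDerivAt_inv (x := ‖c • (m : EuclideanSpace ℝ (Fin (d + 1)))‖)
    (by rw [hn]; exact hc.ne')).comp_hasFDerivAt _ h
  have h1 := (hinv.smul (hasFDerivAt_id _)).prodMk (h.const_mul ((d : ℝ) + 1))
  refine HasFDerivAt.congr_fderiv
    ((jointCLM d).hasFDerivAt.comp (c • (m : EuclideanSpace ℝ (Fin (d + 1)))) h1) ?_
  ext1 z
  rw [momentMapDeriv_apply, ContinuousLinearMap.comp_apply, jointCLM_apply]
  simp only [hn, Function.comp_apply, id_eq, ContinuousLinearMap.prod_apply,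
    smul_apply, add_apply, ContinuousLinearMap.id_apply,
    ContinuousLinearMap.smulRight_apply, innerSL_apply_apply, smul_smul, smul_sub, smul_eq_mul]
  -- Differentiating ‖y‖⁻¹ contributes −c⁻²⟨m, z⟩ · cm, which removes the radial part of c⁻¹z.
  rw [sub_eq_add_neg, ← neg_smul]
  congr 3
  field_simp

theorem map_momentMapDeriv_multivariateGaussian (m : Sph d) {ρ : ℝ} (hρ0 : 0 < ρ)
    (hρ1 : ρ ^ 2 ≤ d + 1) :
    (multivariateGaussian 0 (cardioidCovariance m ρ)).map (momentMapDeriv m (ρ / (d + 1)))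
      = multivariateGaussian 0 (asymptoticCovariance m ρ) := by
  let M : EuclideanSpace ℝ (Fin (d + 1)) := m
  have hM : ⟪M, M⟫ = 1 := by rw [real_inner_self_eq_norm_sq, norm_eq_of_mem_sphere]; norm_num
  let a : EuclideanSpace ℝ (Fin (d + 1) ⊕ Unit) → EuclideanSpace ℝ (Fin (d + 1)) :=
    fun x => WithLp.toLp 2 fun i => x (Sum.inl i)
  -- The transpose of the derivative. Its tangential and radial summands are orthogonal, so no cross
  -- terms survive in the quadratic form.
  let B : EuclideanSpace ℝ (Fin (d + 1) ⊕ Unit) → EuclideanSpace ℝ (Fin (d + 1)) := fun x =>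
    (ρ / (d + 1))⁻¹ • (a x - ⟪M, a x⟫ • M) + (((d : ℝ) + 1) * x (Sum.inr ())) • M
  have ha (u t) : a (joint u t) = u := rfl
  have hb (u : EuclideanSpace ℝ (Fin (d + 1))) (t) : joint u t (Sum.inr ()) = t := rfl
  refine map_multivariateGaussian_zero (posSemidef_cardioidCovariance m hρ1)
    (posSemidef_asymptoticCovariance m hρ1) (B := B) (fun z x => ?_) fun x => ?_
  · obtain ⟨u, t, rfl⟩ := exists_eq_joint x
    rw [momentMapDeriv_apply, inner_joint]
    simp only [B, ha, hb, inner_add_right, inner_sub_left, inner_sub_right, real_inner_smul_left,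
      real_inner_smul_right, M, real_inner_comm z]
    ring
  · obtain ⟨u, t, rfl⟩ := exists_eq_joint x
    rw [dotProduct_asymptoticCovariance, cardioidCovariance, dotProduct_smul_one_sub_vecMulVec,
      ← real_inner_self_eq_norm_sq, ← real_inner_self_eq_norm_sq]
    change _ * ⟪B _, B _⟫ - _ * ⟪M, B _⟫ ^ 2 = _ * (_ - ⟪M, _⟫ ^ 2) + _
    simp only [B, ha, hb, inner_add_right, inner_add_left, inner_sub_left, inner_sub_right,
      real_inner_smul_left, real_inner_smul_right, hM, real_inner_comm M u]
    field_simp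
    ring

end Estimators

/-! ### Transfer of the moments to the sample, and the theorem. -/

section Sample

open scoped RealInnerProductSpace

variable {d : ℕ} {Ω : Type*} [MeasurableSpace Ω] {P : Measure Ω} {m : Sph d} {ρ : ℝ}

theorem integral_inner_of_hasLaw_cardioid (hd : 1 ≤ d) (hρ0 : 0 < ρ) (hρ1 : ρ < 1) {X : Ω → Sph d}
    (hX : HasLaw X (cardioid d 1 m ρ) P) (u : EuclideanSpace ℝ (Fin (d + 1))) :
    ∫ ω, ⟪(X ω : EuclideanSpace ℝ (Fin (d + 1))), u⟫ ∂P
      = ρ / (d + 1) * ⟪(m : EuclideanSpace ℝ (Fin (d + 1))), u⟫ := by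
  rw [← integral_inner_cardioid hd m hρ0 hρ1 u, ← hX.map_eq,
    integral_map hX.aemeasurable (by fun_prop)]

variable [IsProbabilityMeasure P]

theorem memLp_coe_sphere {X : Ω → Sph d} (hX : AEMeasurable X P) (p : ENNReal) :
    MemLp (fun ω => (X ω : EuclideanSpace ℝ (Fin (d + 1)))) p P :=
  MemLp.of_bound (measurable_subtype_coe.comp_aemeasurable hX).aestronglyMeasurable 1
    (ae_of_all _ fun ω => (norm_eq_of_mem_sphere (X ω)).le)

theorem integral_of_hasLaw_cardioid (hd : 1 ≤ d) (hρ0 : 0 < ρ) (hρ1 : ρ < 1) {X : Ω → Sph d}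
    (hX : HasLaw X (cardioid d 1 m ρ) P) :
    ∫ ω, (X ω : EuclideanSpace ℝ (Fin (d + 1))) ∂P
      = (ρ / (d + 1)) • (m : EuclideanSpace ℝ (Fin (d + 1))) := by
  refine ext_inner_left ℝ fun u => ?_
  rw [← integral_inner ((memLp_coe_sphere hX.aemeasurable 1).integrable le_rfl),
    real_inner_smul_right, real_inner_comm _ u,
    ← integral_inner_of_hasLaw_cardioid hd hρ0 hρ1 hX u]
  simp_rw [real_inner_comm]

theorem variance_inner_of_hasLaw_cardioid (hd : 1 ≤ d) (hρ0 : 0 < ρ) (hρ1 : ρ < 1) {X : Ω → Sph d}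
    (hX : HasLaw X (cardioid d 1 m ρ) P) (u : EuclideanSpace ℝ (Fin (d + 1))) :
    Var[fun ω => ⟪(X ω : EuclideanSpace ℝ (Fin (d + 1))), u⟫; P]
      = u ⬝ᵥ cardioidCovariance m ρ *ᵥ u := by
  rw [variance_eq_sub ((memLp_coe_sphere hX.aemeasurable 2).inner_const u),
    integral_inner_of_hasLaw_cardioid hd hρ0 hρ1 hX, cardioidCovariance,
    dotProduct_smul_one_sub_vecMulVec]
  have h : ∫ ω, ⟪(X ω : EuclideanSpace ℝ (Fin (d + 1))), u⟫ ^ 2 ∂P = ‖u‖ ^ 2 / (d + 1) := by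
    rw [← integral_inner_sq_cardioid hd m hρ0 hρ1 u, ← hX.map_eq,
      integral_map hX.aemeasurable (by fun_prop)]
  simp only [Pi.pow_apply, h]
  ring

theorem joint_estimators_sub_eq {c : ℝ} (hc : 0 < c) (n : ℕ) (x : ℕ → Sph d) :
    joint (locationEstimator n x - (m : EuclideanSpace ℝ (Fin (d + 1))))
        (concentrationEstimator n x - (d + 1) * c)
      = momentMap d (sampleMean n x)
        - momentMap d (c • (m : EuclideanSpace ℝ (Fin (d + 1)))) := by
  rw [momentMap, momentMap, norm_smul_sphere m hc, inv_smul_smul₀ hc.ne']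
  exact map_sub (jointCLM d) (locationEstimator n x, concentrationEstimator n x)
    ((m : EuclideanSpace ℝ (Fin (d + 1))), (d + 1) * c)

end Sample

end SphericalCardioid

theorem theorem2 (d : ℕ) (hd : 1 ≤ d) (m : SphericalCardioid.Sph d) (ρ : ℝ)
    (hρ0 : 0 < ρ) (hρ1 : ρ < 1)
    {Ω : Type*} [MeasurableSpace Ω] (P : Measure Ω) [IsProbabilityMeasure P]
    (X : ℕ → Ω → SphericalCardioid.Sph d)
    (hlaw : ∀ i, HasLaw (X i) (SphericalCardioid.cardioid d 1 m ρ) P)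
    (hindep : iIndepFun X P) :
    (∀ᵐ ω ∂P, Tendsto
      (fun n : ℕ =>
        (SphericalCardioid.locationEstimator n (fun i => X i ω),
          SphericalCardioid.concentrationEstimator n (fun i => X i ω)))
      atTop (𝓝 ((m : EuclideanSpace ℝ (Fin (d + 1))), ρ))) ∧
    (SphericalCardioid.asymptoticCovariance m ρ).PosSemidef ∧
    TendstoInDistribution
      (fun (n : ℕ) (ω : Ω) =>
        Real.sqrt (n : ℝ) • SphericalCardioid.joint
          (SphericalCardioid.locationEstimator n (fun i => X i ω)
            - (m : EuclideanSpace ℝ (Fin (d + 1))))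
          (SphericalCardioid.concentrationEstimator n (fun i => X i ω) - ρ))
      atTop id (fun _ => P)
      (multivariateGaussian 0 (SphericalCardioid.asymptoticCovariance m ρ)) := by
  have hc : 0 < ρ / ((d : ℝ) + 1) := by positivity
  have hρc : ((d : ℝ) + 1) * (ρ / (d + 1)) = ρ := by field_simp
  have hρd : ρ ^ 2 ≤ (d : ℝ) + 1 := by nlinarith [(Nat.cast_nonneg d : (0 : ℝ) ≤ d)]
  let Y : ℕ → Ω → EuclideanSpace ℝ (Fin (d + 1)) := fun i ω => X i ω
  have hLp : MemLp (Y 0) 2 P := SphericalCardioid.memLp_coe_sphere (hlaw 0).aemeasurable 2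
  have hYindep : iIndepFun Y P :=
    hindep.comp (fun _ (x : SphericalCardioid.Sph d) => (x : EuclideanSpace ℝ (Fin (d + 1))))
      fun _ => measurable_subtype_coe
  have hYident i : IdentDistrib (Y i) (Y 0) P P :=
    IdentDistrib.comp (u := fun x : SphericalCardioid.Sph d =>
      (x : EuclideanSpace ℝ (Fin (d + 1))))
      ⟨(hlaw i).aemeasurable, (hlaw 0).aemeasurable, by rw [(hlaw i).map_eq, (hlaw 0).map_eq]⟩
      measurable_subtype_coe
  have hmean : P[Y 0] = (ρ / (d + 1)) • (m : EuclideanSpace ℝ (Fin (d + 1))) :=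
    SphericalCardioid.integral_of_hasLaw_cardioid hd hρ0 hρ1 (hlaw 0)
  have hlim : ∀ᵐ ω ∂P, Tendsto (fun n => SphericalCardioid.sampleMean n fun i => X i ω) atTop
      (𝓝 ((ρ / (d + 1)) • (m : EuclideanSpace ℝ (Fin (d + 1))))) := by
    rw [← hmean]
    exact strong_law_ae Y (hLp.integrable (by norm_num))
      (fun i j hij => hYindep.indepFun hij) hYident
  have hclt := SphericalCardioid.tendstoInDistribution_sqrt_smul_mean_sub
    (SphericalCardioid.posSemidef_cardioidCovariance m hρd) hLp hYindep hYident
    (SphericalCardioid.variance_inner_of_hasLaw_cardioid hd hρ0 hρ1 (hlaw 0))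
  rw [hmean] at hclt
  refine ⟨?_, SphericalCardioid.posSemidef_asymptoticCovariance m hρd, ?_⟩
  · filter_upwards [hlim] with ω hω
    have hnorm := hω.norm
    rw [SphericalCardioid.norm_smul_sphere m hc] at hnorm
    -- Here ρ > 0 matters: the direction of the mean is continuous only away from 0.
    have h1 := (hnorm.inv₀ hc.ne').smul hω
    have h2 := hnorm.const_mul ((d : ℝ) + 1)
    rw [inv_smul_smul₀ hc.ne'] at h1
    rw [hρc] at h2
    exact h1.prodMk_nhds h2
  · have h := SphericalCardioid.tendstoInDistribution_delta
      (Y := fun n ω => SphericalCardioid.sampleMean n fun i => X i ω)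
      (fun n => (Finset.aemeasurable_fun_sum (f := Y) (Finset.range n) fun i _ =>
        (hYident i).aemeasurable_fst).const_smul ((n : ℝ)⁻¹))
      (SphericalCardioid.hasFDerivAt_momentMap m hc) SphericalCardioid.measurable_momentMap
      hlim hclt
    refine SphericalCardioid.tendstoInDistribution_id_of_map_eq ?_
      (SphericalCardioid.map_momentMapDeriv_multivariateGaussian m hρ0 hρd)
    simp_rw [← SphericalCardioid.joint_estimators_sub_eq hc, hρc] at h
    exact h
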